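/- Let $(\Omega,\mu)$ be a finite probability space, let $n\ge 0$, and equip $\Omega^n$ with the product measure $\mu^n$. For $S\subseteq[n]$ let $E_S$ be the operator on functions $\Omega^n\to\mathbb{R}$ that averages over independent resampling, according to $\mu$, of the coordinates in $S$; put $L_S=\sum_{T\subseteq S}(-1)^{|T|}E_T$, let $f^{=S}=E_{S^c}L_S f$ be the Efron–Stein components of $f$, and let $f^{=d}=\sum_{|S|=d}f^{=S}$. For $x\in\Omega^S$ let $f_{S\to x}:\Omega^{[n]\setminus S}\to\mathbb{R}$ be the restriction $f_{S\to x}(y)=f(x,y)$. All expectations and norms are with respect to the product measures, and $\log$ is the natural logarithm. **Theorem.** Let $f:\Omega^n\to\{0,1\}$ with $\mathbb{E}[f]>0$, let $r>1$, and let $d\ge 0$ be an integer with $d\le\frac14\log(1/\mathbb{E}[f])$. Suppose that $$\mathbb{E}[f_{S\to x}]\le r^{|S|}\,\mathbb{E}[f]$$ for all $S\subseteq[n]$ with $|S|\le d$ and all $x\in\Omega^S$. Then $$\|f^{=d}\|_2^2\le \mathbb{E}[f]^2\left(\frac{2200\,r^2\log(1/\mathbb{E}[f])}{d}\right)^d,$$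 where for $d=0$ the last factor is understood to be $1$. -/

import Mathlib

open MeasureTheory

noncomputable section

namespace LevelInequality

/-- The expectation `𝔼[g]` of `g : Ω^ι → ℝ` with respect to the product measure `μ^ι`. -/
def expect {ι Ω : Type*} [Fintype ι] [MeasurableSpace Ω] (μ : Measure Ω)
    (g : (ι → Ω) → ℝ) : ℝ :=
  ∫ x, g x ∂(Measure.pi fun _ : ι => μ)

/-- The norm `‖g‖₂` of `g : Ω^ι → ℝ` in `L²(Ω^ι, μ^ι)`. -/
def l2Norm {ι Ω : Type*} [Fintype ι] [MeasurableSpace Ω] (μ : Measure Ω)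
    (g : (ι → Ω) → ℝ) : ℝ :=
  Real.sqrt (expect μ fun x => g x ^ 2)

/-- The restriction `f_{S → x} : Ω^{[n] ∖ S} → ℝ`, `f_{S → x}(y) = f(x, y)`, for `x ∈ Ω^S`. -/
def restrict {n : ℕ} {Ω : Type*} (f : (Fin n → Ω) → ℝ) (S : Finset (Fin n))
    (x : {i // i ∈ S} → Ω) : ({i // i ∉ S} → Ω) → ℝ :=
  fun y => f fun i => if h : i ∈ S then x ⟨i, h⟩ else y ⟨i, h⟩

/-- The averaging operator `E_S`: the expected value of `f` when the coordinates in `S` are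
resampled independently according to `μ`. -/
def avgOn {n : ℕ} {Ω : Type*} [MeasurableSpace Ω] (μ : Measure Ω) (S : Finset (Fin n))
    (f : (Fin n → Ω) → ℝ) : (Fin n → Ω) → ℝ :=
  fun x => expect μ fun y : Fin n → Ω => f (S.piecewise y x)

/-- The Laplacian `L_S = ∑_{T ⊆ S} (-1)^{|T|} E_T`, that is, the tensor product of the operators
`g ↦ g - 𝔼[g]` in the coordinates of `S` and the identity in the other coordinates. -/
def laplacian {n : ℕ} {Ω : Type*} [MeasurableSpace Ω] (μ : Measure Ω) (S : Finset (Fin n))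
    (f : (Fin n → Ω) → ℝ) : (Fin n → Ω) → ℝ :=
  fun x => ∑ T ∈ S.powerset, (-1 : ℝ) ^ T.card * avgOn μ T f x

/-- The Efron–Stein component `f^{=T} = E_{Tᶜ} L_T f`. -/
def efronStein {n : ℕ} {Ω : Type*} [MeasurableSpace Ω] (μ : Measure Ω) (T : Finset (Fin n))
    (f : (Fin n → Ω) → ℝ) : (Fin n → Ω) → ℝ :=
  avgOn μ Tᶜ (laplacian μ T f)

/-- The level-`d` part `f^{=d} = ∑_{|T| = d} f^{=T}`. -/
def levelPart {n : ℕ} {Ω : Type*} [MeasurableSpace Ω] (μ : Measure Ω) (d : ℕ)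
    (f : (Fin n → Ω) → ℝ) : (Fin n → Ω) → ℝ :=
  fun x => ∑ T ∈ Finset.powersetCard d (Finset.univ : Finset (Fin n)), efronStein μ T f x

end LevelInequality

end

set_option linter.unusedSectionVars false

open MeasureTheory

namespace LevelInequality

/-! ### Averaging operators on a finite product space -/

section Averaging

variable {n : ℕ} {Ω : Type*} [Fintype Ω] [MeasurableSpace Ω] [MeasurableSingletonClass Ω]
  (μ : Measure Ω) [IsProbabilityMeasure μ]

/-! Write p = E[f], L = log(1/p), ρ = 1 + r. A bound is proved for all derivatives of f at once: for
|S| + e = d, the weight W_S = ∑ E_{Sᶜ}[(f^{=U})²] over U ⊇ S, |U| = d, is at most ρ^{2|S|} p²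
(550ρ²L/e)^e at every point (`weightAbove_le`). The theorem is the case S = ∅.

Self-adjointness gives W_S = E_{Sᶜ}[L_S f · g], with g the sum of the f^{=U} over those U
(`weightAbove_eq`). Hölder bounds this by the L¹ and L² norms of L_S f, which globalness controls,
and the 2m-th moment of g. That moment is controlled by replacing coordinates by Gaussians one at a
time: each costs either variance 7m or a Laplacian term with factor (16m²)^m
(`avg_gaussForm_pow_le`, `avg_pow_le_sum`). If the weights of further derivatives decay
geometrically relative to W_S, the result is hypercontractive: E[g^{2m}] ≤ Q^e W_S^m
(`avg_levelAbove_pow_le_weightAbove`).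

Decay comes for free by contradiction: if W_S exceeds its target, the inductive bounds on larger
sets are small relative to W_S. Taking m about L/(2e) then gives the target after all. -/

theorem expect_eq_sum {ι : Type*} [Fintype ι] [DecidableEq ι] (g : (ι → Ω) → ℝ) :
    expect μ g = ∑ y, (∏ i, μ.real {y i}) * g y := by
  unfold expect
  rw [integral_fintype (Integrable.of_finite)]
  refine Finset.sum_congr rfl fun y _ => ?_
  simp [Measure.real, Measure.pi_singleton, ENNReal.toReal_prod]

theorem expect_add {ι : Type*} [Fintype ι] (g h : (ι → Ω) → ℝ) :
    expect μ (fun x => g x + h x) = expect μ g + expect μ h :=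
  integral_add Integrable.of_finite Integrable.of_finite

theorem expect_const_mul {ι : Type*} [Fintype ι] (c : ℝ) (g : (ι → Ω) → ℝ) :
    expect μ (fun x => c * g x) = c * expect μ g :=
  integral_const_mul c _

theorem expect_const {ι : Type*} [Fintype ι] (c : ℝ) :
    expect μ (fun _ : ι → Ω => c) = c := by
  simp [expect]

theorem expect_mono {ι : Type*} [Fintype ι] {g h : (ι → Ω) → ℝ} (H : ∀ x, g x ≤ h x) :
    expect μ g ≤ expect μ h :=
  integral_mono Integrable.of_finite Integrable.of_finite H

/-- Resampling one coordinate does not change the expectation. -/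
theorem expect_resample {ι : Type*} [Fintype ι] [DecidableEq ι] (i : ι) (g : (ι → Ω) → ℝ) :
    expect μ g = expect μ fun y => expect μ fun z : ι → Ω => g (Function.update y i (z i)) := by
  have key : ∀ y z : ι → Ω,
      (∏ j, μ.real {Function.update y i (z i) j}) * ∏ j, μ.real {Function.update z i (y i) j}
        = (∏ j, μ.real {y j}) * ∏ j, μ.real {z j} := by
    intro y z
    rw [← Finset.prod_mul_distrib, ← Finset.prod_mul_distrib]
    refine Finset.prod_congr rfl fun j _ => ?_
    by_cases h : j = i
    · subst h; simp [mul_comm]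
    · simp [h]
  have h1 : ∑ y : ι → Ω, (∏ i, μ.real {y i}) = 1 := by
    have := expect_eq_sum μ (fun _ : ι → Ω => (1 : ℝ))
    rw [expect_const] at this
    simpa using this.symm
  simp only [expect_eq_sum, Finset.mul_sum]
  have h2 : ∑ y : ι → Ω, (∏ i, μ.real {y i}) * g y
      = ∑ p : (ι → Ω) × (ι → Ω), (∏ j, μ.real {p.1 j}) * (∏ j, μ.real {p.2 j}) * g p.1 := by
    rw [Fintype.sum_prod_type]
    refine Finset.sum_congr rfl fun y _ => ?_
    dsimp only
    rw [← Finset.sum_mul, ← Finset.mul_sum, h1, mul_one]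
  rw [h2, ← Finset.sum_product', Finset.univ_product_univ]
  -- Exchanging the i-th coordinates of two independent copies is an involution that preserves the
  -- product weight.
  refine Finset.sum_bij' (fun p _ => (Function.update p.1 i (p.2 i), Function.update p.2 i (p.1 i)))
    (fun p _ => (Function.update p.1 i (p.2 i), Function.update p.2 i (p.1 i)))
    (by simp) (by simp) (by simp) (by simp) ?_
  rintro ⟨y, z⟩ -
  simp only
  rw [← mul_assoc, key]
  simp

/-- The averaging operator as a linear map. -/
noncomputable def avg (S : Finset (Fin n)) :
    ((Fin n → Ω) → ℝ) →ₗ[ℝ] ((Fin n → Ω) → ℝ) where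
  toFun := avgOn μ S
  map_add' f g := by
    funext x
    exact expect_add μ _ _
  map_smul' c f := by
    funext x
    exact expect_const_mul μ c _

theorem avg_apply (S : Finset (Fin n)) (f : (Fin n → Ω) → ℝ) (x : Fin n → Ω) :
    avg μ S f x = expect μ fun y : Fin n → Ω => f (S.piecewise y x) := rfl

theorem avg_mono (S : Finset (Fin n)) {f g : (Fin n → Ω) → ℝ} (h : f ≤ g) :
    avg μ S f ≤ avg μ S g :=
  fun _ => expect_mono μ fun _ => h _

theorem avg_nonneg (S : Finset (Fin n)) {f : (Fin n → Ω) → ℝ} (h : 0 ≤ f) :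
    0 ≤ avg μ S f := by
  simpa using avg_mono μ S h

@[simp]
theorem avg_empty : avg μ (∅ : Finset (Fin n)) = 1 := by
  ext f x
  simp [avg_apply, expect_const]

theorem avg_univ_apply (f : (Fin n → Ω) → ℝ) (x : Fin n → Ω) :
    avg μ Finset.univ f x = expect μ f := by
  simp [avg_apply]

theorem avg_singleton_apply (i : Fin n) (f : (Fin n → Ω) → ℝ) (x : Fin n → Ω) :
    avg μ {i} f x = expect μ fun y : Fin n → Ω => f (Function.update x i (y i)) := by
  simp only [avg_apply]
  congr 1; funext y; congr 1
  rw [Finset.piecewise_singleton]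

theorem avg_insert_eq_mul {i : Fin n} {S : Finset (Fin n)} (hi : i ∉ S) :
    avg μ (insert i S) = avg μ S * avg μ {i} := by
  ext f x
  rw [Module.End.mul_apply, avg_apply, avg_apply, expect_resample μ i]
  congr 1; funext y
  rw [avg_singleton_apply]
  congr 1; funext z; congr 1
  funext j
  by_cases h : j = i
  · subst h; simp [Finset.piecewise]
  · simp [Finset.piecewise, h]

theorem avg_insert {i : Fin n} {S : Finset (Fin n)} (hi : i ∉ S) :
    avg μ (insert i S) = avg μ {i} * avg μ S := by
  ext f x
  rw [Module.End.mul_apply, avg_apply, avg_singleton_apply, expect_resample μ i]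
  simp only [avg_apply]
  have : ∀ y z : Fin n → Ω, (insert i S).piecewise (Function.update y i (z i)) x
      = S.piecewise y (Function.update x i (z i)) := by
    intro y z
    funext j
    by_cases h : j = i
    · subst h; simp [Finset.piecewise, hi]
    · simp [Finset.piecewise, h]
  simp only [this]
  simp only [expect_eq_sum, Finset.mul_sum]
  rw [Finset.sum_comm]
  refine Finset.sum_congr rfl fun y _ => Finset.sum_congr rfl fun z _ => by ring

theorem avg_singleton_idem (i : Fin n) : avg μ {i} * avg μ {i} = avg μ {i} := by
  ext f x
  simp only [Module.End.mul_apply, avg_singleton_apply, Function.update_idem, expect_const]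

theorem avg_singleton_mul (i : Fin n) (S : Finset (Fin n)) :
    avg μ {i} * avg μ S = avg μ (insert i S) := by
  by_cases hi : i ∈ S
  · obtain ⟨T, hT, rfl⟩ : ∃ T, i ∉ T ∧ S = insert i T :=
      ⟨S.erase i, by simp, (Finset.insert_erase hi).symm⟩
    rw [Finset.insert_idem, avg_insert μ hT, ← mul_assoc, avg_singleton_idem]
  · rw [avg_insert μ hi]

theorem avg_mul (S T : Finset (Fin n)) : avg μ S * avg μ T = avg μ (S ∪ T) := by
  induction S using Finset.induction_on with
  | empty => simp
  | insert i S hi ih =>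
    rw [avg_insert μ hi, mul_assoc, ih, avg_singleton_mul, Finset.insert_union]

theorem avg_avg (S T : Finset (Fin n)) (f : (Fin n → Ω) → ℝ) :
    avg μ S (avg μ T f) = avg μ (S ∪ T) f := by
  rw [← Module.End.mul_apply, avg_mul]

theorem avg_commute (S T : Finset (Fin n)) : Commute (avg μ S) (avg μ T) := by
  rw [Commute, SemiconjBy, avg_mul, avg_mul, Finset.union_comm]

/-- A fixed point of E_S does not depend on the coordinates in S, so it leaves the average as a
constant. -/
theorem avg_mul_of_avg_eq {S : Finset (Fin n)} {u : (Fin n → Ω) → ℝ} (hu : avg μ S u = u)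
    (v : (Fin n → Ω) → ℝ) : avg μ S (u * v) = u * avg μ S v := by
  have h : ∀ x y, u (S.piecewise y x) = u x := by
    intro x y
    rw [← hu, avg_apply, avg_apply]
    simp [Finset.piecewise_idem_right]
  funext x
  simp only [avg_apply, Pi.mul_apply, h, expect_const_mul]

theorem avg_mul_eq {S : Finset (Fin n)} {u v : (Fin n → Ω) → ℝ} (hu : avg μ S u = u)
    (hv : avg μ S v = v) : avg μ S (u * v) = u * v := by
  rw [avg_mul_of_avg_eq μ hu, hv]

theorem avg_one (S : Finset (Fin n)) : avg μ S (1 : (Fin n → Ω) → ℝ) = 1 := by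
  funext x
  simp [avg_apply, expect_const]

theorem avg_pow_eq {S : Finset (Fin n)} {u : (Fin n → Ω) → ℝ} (hu : avg μ S u = u) (k : ℕ) :
    avg μ S (u ^ k) = u ^ k := by
  induction k with
  | zero => simpa using avg_one μ S
  | succ k ih => rw [pow_succ, avg_mul_eq μ ih hu]

/-- Averaging operators are self-adjoint. -/
theorem avg_mul_avg {S T : Finset (Fin n)} (h : T ⊆ S) (u v : (Fin n → Ω) → ℝ) :
    avg μ S (avg μ T u * v) = avg μ S (u * avg μ T v) := by
  have hid : ∀ w : (Fin n → Ω) → ℝ, avg μ T (avg μ T w) = avg μ T w := by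
    intro w; rw [avg_avg, Finset.union_idempotent]
  have hS : ∀ w : (Fin n → Ω) → ℝ, avg μ S w = avg μ S (avg μ T w) := by
    intro w; rw [avg_avg, Finset.union_eq_left.2 h]
  rw [hS, avg_mul_of_avg_eq μ (hid u), hS (u * _), mul_comm u, avg_mul_of_avg_eq μ (hid v),
    mul_comm]

/-- The expectation of a restriction is an average over the remaining coordinates. -/
theorem avg_compl_eq_expect_restrict (S : Finset (Fin n)) (f : (Fin n → Ω) → ℝ)
    (x : Fin n → Ω) :
    avg μ Sᶜ f x = expect μ (restrict f S fun i => x i) := by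
  have hmp : MeasurePreserving (MeasurableEquiv.piEquivPiSubtypeProd (fun _ => Ω) (· ∈ S))
      (Measure.pi fun _ : Fin n => μ) ((Measure.pi fun _ : {i // i ∈ S} => μ).prod
        (Measure.pi fun _ : {i // i ∉ S} => μ)) := by
    convert measurePreserving_piEquivPiSubtypeProd (fun _ : Fin n => μ) (fun i => i ∈ S)
  have hsnd := (measurePreserving_snd (μ := Measure.pi fun _ : {i // i ∈ S} => μ)
    (ν := Measure.pi fun _ : {i // i ∉ S} => μ)).comp hmp
  rw [avg_apply, expect, expect, ← hsnd.map_eq,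
    integral_map hsnd.measurable.aemeasurable (Measurable.of_discrete).aestronglyMeasurable]
  refine integral_congr_ae (Filter.Eventually.of_forall fun y => ?_)
  simp only [restrict]
  congr 1
  funext i
  by_cases h : i ∈ S
  · simp [h, Finset.piecewise]
  · simp [h, Finset.piecewise, MeasurableEquiv.piEquivPiSubtypeProd,
      Equiv.piEquivPiSubtypeProd]

end Averaging

/-! ### Scalar inequalities and Hölder -/

/-- With s = √V, so |U| ≤ s: if 3ms ≤ 1, compare with exp t for t = m(2U + s²) and use exp t ≤ 1 + t
+ t². Otherwise 1 + s ≤ 4ms, so the last term dominates the left side, and 7m²V absorbs a negative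
linear term. -/
theorem pow_one_add_le (m : ℕ) (hm : 1 ≤ m) {U V : ℝ} (hV : 0 ≤ V) (hU : U ^ 2 ≤ V) :
    (1 + 2 * U + V) ^ m
      ≤ 1 + 2 * m * U + 7 * (m : ℝ) ^ 2 * V + (16 * (m : ℝ) ^ 2 * V) ^ m := by
  have hm' : (1 : ℝ) ≤ m := by exact_mod_cast hm
  obtain ⟨s, hs, rfl⟩ : ∃ s : ℝ, 0 ≤ s ∧ V = s ^ 2 := ⟨√V, by positivity, by simp [hV]⟩
  have hUs : |U| ≤ s := abs_le_of_sq_le_sq hU hs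
  obtain ⟨h1, h2⟩ := abs_le.1 hUs
  have h0 : 0 ≤ 1 + 2 * U + s ^ 2 := by nlinarith [sq_nonneg (1 - s)]
  rcases le_or_gt (3 * m * s) 1 with h | h
  · have hs1 : 3 * s ≤ 1 := by nlinarith
    set t : ℝ := m * (2 * U + s ^ 2) with ht
    have hms : (m : ℝ) * s ≤ 1 / 3 := by linarith
    have hms0 : 0 ≤ (m : ℝ) * s := by positivity
    have hta : |t| ≤ 7 / 3 * (m * s) := by
      rw [ht, abs_le]
      constructor <;> nlinarith
    have ht1 : |t| ≤ 1 := by linarith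
    have hexp : Real.exp t ≤ 1 + t + t ^ 2 := by
      have := (abs_le.1 (Real.abs_exp_sub_one_sub_id_le ht1)).2
      linarith
    have hpow : (1 + 2 * U + s ^ 2) ^ m ≤ Real.exp t := by
      rw [ht, Real.exp_nat_mul]
      refine pow_le_pow_left₀ h0 ?_ m
      have := Real.add_one_le_exp (2 * U + s ^ 2)
      linarith
    have ht2 : t ^ 2 ≤ 6 * (m * s) ^ 2 := by
      have := pow_le_pow_left₀ (abs_nonneg t) hta 2
      rw [sq_abs] at this
      nlinarith
    have h3 : (m : ℝ) * s ^ 2 ≤ (m * s) ^ 2 := by nlinarith [sq_nonneg s]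
    have h4 : 0 ≤ (16 * (m : ℝ) ^ 2 * s ^ 2) ^ m := by positivity
    nlinarith
  · have h3 : (1 + 2 * U + s ^ 2) ^ m ≤ (16 * (m : ℝ) ^ 2 * s ^ 2) ^ m := by
      refine pow_le_pow_left₀ h0 ?_ m
      have : 1 + s ≤ 4 * m * s := by nlinarith
      nlinarith
    have h4 : 0 ≤ (m : ℝ) * s := by positivity
    have h5 : (m : ℝ) * s ≤ 3 * (m * s) ^ 2 := by nlinarith
    nlinarith

/-- Homogeneous form of the preceding bound. The term linear in U is kept exact because it will
average to zero; only terms in V remain to be paid for. -/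
theorem pow_add_le (m : ℕ) (hm : 1 ≤ m) {A U V : ℝ} (hA : 0 ≤ A) (hV : 0 ≤ V)
    (hU : U ^ 2 ≤ A * V) :
    (A + 2 * U + V) ^ m
      ≤ A ^ m + 2 * m * (A ^ (m - 1) * U) + 7 * (m : ℝ) ^ 2 * (A ^ (m - 1) * V)
        + (16 * (m : ℝ) ^ 2) ^ m * V ^ m := by
  have hm' : (1 : ℝ) ≤ m := by exact_mod_cast hm
  rcases hA.eq_or_lt with rfl | hA
  · have hU0 : U = 0 := by
      have : U ^ 2 ≤ 0 := by simpa using hU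
      exact pow_eq_zero_iff two_ne_zero |>.1 (le_antisymm this (sq_nonneg U))
    subst hU0
    have h1 : V ^ m ≤ (16 * (m : ℝ) ^ 2) ^ m * V ^ m :=
      le_mul_of_one_le_left (by positivity) (one_le_pow₀ (by nlinarith))
    have h2 : 0 ≤ 7 * (m : ℝ) ^ 2 * (0 ^ (m - 1) * V) := by positivity
    have h3 : (0 : ℝ) ^ m = 0 := zero_pow (by omega)
    simp only [zero_add, mul_zero, h3]
    linarith
  · have h := pow_one_add_le m hm (U := U / A) (V := V / A) (by positivity)
      (by rw [div_pow, div_le_div_iff₀ (by positivity) hA]; nlinarith)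
    have h' := mul_le_mul_of_nonneg_left h (pow_nonneg hA.le m)
    obtain ⟨k, rfl⟩ : ∃ k, m = k + 1 := ⟨m - 1, by omega⟩
    have e1 : A ^ (k + 1) * (1 + 2 * (U / A) + V / A) ^ (k + 1) = (A + 2 * U + V) ^ (k + 1) := by
      rw [← mul_pow]; congr 1; field_simp
    rw [e1] at h'
    refine h'.trans (le_of_eq ?_)
    have e2 : A ^ (k + 1) * (16 * ((k + 1 : ℕ) : ℝ) ^ 2 * (V / A)) ^ (k + 1)
        = (16 * ((k + 1 : ℕ) : ℝ) ^ 2) ^ (k + 1) * V ^ (k + 1) := by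
      rw [← mul_pow, ← mul_pow]; congr 1; field_simp
    rw [mul_add, e2]
    congr 1
    rw [add_tsub_cancel_right, pow_succ]
    field_simp

/-- `1 + k / j ≤ exp (k / j)` in multiplicative form. -/
theorem add_pow_le_pow_mul_exp (j k : ℕ) :
    ((j + k : ℕ) : ℝ) ^ j ≤ (j : ℝ) ^ j * Real.exp 1 ^ k := by
  rcases Nat.eq_zero_or_pos j with rfl | hj
  · simp
  · have hj' : (0 : ℝ) < j := by exact_mod_cast hj
    have h := Real.add_one_le_exp ((k : ℝ) / j)
    have h2 : ((j + k : ℕ) : ℝ) ≤ j * Real.exp (k / j) := by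
      have := mul_le_mul_of_nonneg_left h hj'.le
      refine le_trans (le_of_eq ?_) this
      push_cast; field_simp; ring
    calc ((j + k : ℕ) : ℝ) ^ j ≤ (j * Real.exp (k / j)) ^ j :=
          pow_le_pow_left₀ (by positivity) h2 j
      _ = _ := by
          rw [mul_pow, ← Real.exp_nat_mul, ← Real.exp_nat_mul]
          congr 2; field_simp

/-- The numerical inequality that closes the induction, with X = L/e. The constant 550 makes θ = exp
1 / (550X) small enough that the Laplacian cost per coordinate is harmless. -/
theorem exp_mul_add_le {m : ℕ} {X : ℝ} (hX : 4 ≤ X) (h1 : X / 2 ≤ m) (h2 : (m : ℝ) ≤ 3 / 4 * X) :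
    Real.exp 2 ^ m * ((7 * (m : ℝ)) ^ m
        + (16 * (m : ℝ) ^ 2) ^ m * (Real.exp 1 / (550 * X)) ^ (m - 1)) ≤ (550 * X) ^ m := by
  have he : Real.exp 1 < 2.7182818286 := Real.exp_one_lt_d9
  have he' : 1 < Real.exp 1 := Real.one_lt_exp_iff.2 one_pos
  have he2 : Real.exp 2 < 7.39 := by
    have : Real.exp 2 = Real.exp 1 ^ 2 := by rw [← Real.exp_nat_mul]; norm_num
    rw [this]; nlinarith
  have hX0 : 0 < X := by linarith
  have hm2 : 2 ≤ m := by
    have : (2 : ℝ) ≤ m := by linarith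
    exact_mod_cast this
  have hm0 : (0 : ℝ) < m := by linarith
  set θ := Real.exp 1 / (550 * X) with hθ
  have hθ0 : 0 < θ := by positivity
  have e1 : θ ^ m = θ ^ (m - 1) * θ := by rw [← pow_succ]; congr 1; omega
  -- Writing θ^(m-1) as θ^m θ⁻¹ leaves a stray θ⁻¹. As X ≥ 4 forces m ≥ 2, it is at most 40^m · 2^m.
  have hθi : θ⁻¹ ≤ 1100 * m := by
    rw [hθ, inv_div, div_le_iff₀ (by positivity)]
    nlinarith
  have hm1 : (m : ℝ) ≤ 2 ^ m := by exact_mod_cast Nat.lt_two_pow_self.le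
  have h1100 : (1100 : ℝ) ≤ 40 ^ m :=
    le_trans (by norm_num) (pow_le_pow_right₀ (by norm_num) hm2)
  have t1 : Real.exp 2 ^ m * (7 * (m : ℝ)) ^ m ≤ (50 * X) ^ m := by
    rw [← mul_pow]
    refine pow_le_pow_left₀ (by positivity) ?_ m
    nlinarith
  have t2 : Real.exp 2 ^ m * ((16 * (m : ℝ) ^ 2) ^ m * θ ^ (m - 1)) ≤ (80 * X) ^ m := by
    have e3 : Real.exp 2 ^ m * ((16 * (m : ℝ) ^ 2) ^ m * θ ^ (m - 1))
        = (Real.exp 2 * (16 * (m : ℝ) ^ 2) * θ) ^ m * θ⁻¹ := by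
      rw [mul_pow _ θ, mul_pow (Real.exp 2), e1]; field_simp
    have hb : Real.exp 2 * (16 * (m : ℝ) ^ 2) * θ ≤ X := by
      have : Real.exp 2 * (16 * (m : ℝ) ^ 2) ≤ 7.39 * (16 * (3 / 4 * X) ^ 2) := by gcongr
      calc Real.exp 2 * (16 * (m : ℝ) ^ 2) * θ ≤ 7.39 * (16 * (3 / 4 * X) ^ 2) * θ := by gcongr
        _ = 7.39 * 9 * X * Real.exp 1 / 550 := by rw [hθ]; field_simp; ring
        _ ≤ X := by rw [div_le_iff₀ (by norm_num)]; nlinarith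
    calc _ = (Real.exp 2 * (16 * (m : ℝ) ^ 2) * θ) ^ m * θ⁻¹ := e3
      _ ≤ X ^ m * (40 ^ m * 2 ^ m) := by
          gcongr
          exact hθi.trans (by gcongr)
      _ = (80 * X) ^ m := by rw [← mul_pow, ← mul_pow]; congr 1; ring
  have t3 : (50 * X) ^ m + (80 * X) ^ m ≤ (50 * X + 80 * X) ^ m :=
    pow_add_pow_le (by positivity) (by positivity) (by omega)
  have t4 : (50 * X + 80 * X) ^ m ≤ (550 * X) ^ m :=
    pow_le_pow_left₀ (by positivity) (by linarith) m
  rw [mul_add]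
  linarith

theorem sum_mul_pow_le {ι : Type*} (s : Finset ι) (w a : ι → ℝ) (hw : ∀ i, 0 ≤ w i)
    (ha : ∀ i, 0 ≤ a i) {m : ℕ} (hm : 1 ≤ m) :
    (∑ i ∈ s, w i * a i) ^ m ≤ (∑ i ∈ s, w i) ^ (m - 1) * ∑ i ∈ s, w i * a i ^ m := by
  have hm' : (1 : ℝ) ≤ m := by exact_mod_cast hm
  have hm0 : (m : ℝ) ≠ 0 := by positivity
  have h := Real.inner_le_weight_mul_Lp_of_nonneg s hm' w a hw ha
  have h0 : 0 ≤ ∑ i ∈ s, w i * a i := Finset.sum_nonneg fun i _ => mul_nonneg (hw i) (ha i)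
  have hw0 : 0 ≤ ∑ i ∈ s, w i := Finset.sum_nonneg fun i _ => hw i
  have h1 : 0 ≤ ∑ i ∈ s, w i * a i ^ m :=
    Finset.sum_nonneg fun i _ => mul_nonneg (hw i) (pow_nonneg (ha i) m)
  refine (pow_le_pow_left₀ h0 h m).trans (le_of_eq ?_)
  simp only [Real.rpow_natCast]
  rw [mul_pow, ← Real.rpow_natCast, ← Real.rpow_mul hw0, ← Real.rpow_natCast (_ ^ (m : ℝ)⁻¹),
    ← Real.rpow_mul h1, inv_mul_cancel₀ hm0, Real.rpow_one, sub_mul, inv_mul_cancel₀ hm0, one_mul,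
    ← Real.rpow_natCast _ (m - 1), Nat.cast_sub hm, Nat.cast_one]

/-- Power mean with weights w|g|, then Cauchy–Schwarz. Only the first two moments of g enter, so for
a derivative of a sparse indicator the loss is a single factor 1/p. -/
theorem abs_sum_mul_mul_pow_le {ι : Type*} (s : Finset ι) (w g h : ι → ℝ) (hw : ∀ i, 0 ≤ w i)
    {m : ℕ} (hm : 1 ≤ m) :
    (∑ i ∈ s, w i * (g i * h i)) ^ (2 * m)
      ≤ (∑ i ∈ s, w i * |g i|) ^ (2 * (m - 1)) * (∑ i ∈ s, w i * g i ^ 2)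
        * ∑ i ∈ s, w i * h i ^ (2 * m) := by
  have h1 := sum_mul_pow_le s (fun i => w i * |g i|) (fun i => |h i|)
    (fun i => mul_nonneg (hw i) (abs_nonneg _)) (fun i => abs_nonneg _) hm
  have h2 : (∑ i ∈ s, w i * |g i| * |h i| ^ m) ^ 2
      ≤ (∑ i ∈ s, w i * g i ^ 2) * ∑ i ∈ s, w i * h i ^ (2 * m) := by
    refine Finset.sum_sq_le_sum_mul_sum_of_sq_le_mul s
      (fun i _ => mul_nonneg (hw i) (sq_nonneg _))
      (fun i _ => mul_nonneg (hw i) ((even_two_mul m).pow_nonneg _)) fun i _ => le_of_eq ?_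
    rw [mul_pow, mul_pow, sq_abs, ← pow_mul, mul_comm m 2, (even_two_mul m).pow_abs]
    ring
  have h3 : |∑ i ∈ s, w i * (g i * h i)| ≤ ∑ i ∈ s, w i * |g i| * |h i| := by
    refine (Finset.abs_sum_le_sum_abs _ _).trans (le_of_eq (Finset.sum_congr rfl fun i _ => ?_))
    rw [abs_mul, abs_mul, abs_of_nonneg (hw i), mul_assoc]
  calc (∑ i ∈ s, w i * (g i * h i)) ^ (2 * m)
      = (|∑ i ∈ s, w i * (g i * h i)| ^ m) ^ 2 := by
        rw [← pow_mul, mul_comm m 2, (even_two_mul m).pow_abs]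
    _ ≤ ((∑ i ∈ s, w i * |g i|) ^ (m - 1) * ∑ i ∈ s, w i * |g i| * |h i| ^ m) ^ 2 := by
        gcongr
        exact (pow_le_pow_left₀ (abs_nonneg _) h3 m).trans h1
    _ ≤ _ := by
        rw [mul_pow, ← pow_mul, mul_comm (m - 1) 2, mul_assoc]
        gcongr
        exact (even_two_mul _).pow_nonneg _

/-! ### Laplacians, Efron–Stein projections and Gaussian replacement -/

section Operators

variable {n : ℕ} {Ω : Type*} [Fintype Ω] [MeasurableSpace Ω] [MeasurableSingletonClass Ω]
  (μ : Measure Ω) [IsProbabilityMeasure μ]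

/-- Hölder's inequality for averages, with an even integer exponent. -/
theorem avg_mul_pow_le (S : Finset (Fin n)) (g h : (Fin n → Ω) → ℝ) {m : ℕ} (hm : 1 ≤ m)
    (x : Fin n → Ω) :
    avg μ S (g * h) x ^ (2 * m)
      ≤ avg μ S |g| x ^ (2 * (m - 1)) * avg μ S (g ^ 2) x * avg μ S (h ^ (2 * m)) x := by
  simp only [avg_apply, expect_eq_sum]
  exact abs_sum_mul_mul_pow_le _ _ _ _ (fun y => Finset.prod_nonneg fun _ _ => measureReal_nonneg) hm

theorem sq_avg_mul_le (S : Finset (Fin n)) (g h : (Fin n → Ω) → ℝ) (x : Fin n → Ω) :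
    avg μ S (g * h) x ^ 2 ≤ avg μ S (g ^ 2) x * avg μ S (h ^ 2) x := by
  simpa using avg_mul_pow_le μ S g h le_rfl x

/-- The Laplacian as a linear map. -/
noncomputable def lap (S : Finset (Fin n)) :
    ((Fin n → Ω) → ℝ) →ₗ[ℝ] ((Fin n → Ω) → ℝ) :=
  ∑ T ∈ S.powerset, (-1 : ℝ) ^ T.card • avg μ T

theorem lap_eq_laplacian (S : Finset (Fin n)) (f : (Fin n → Ω) → ℝ) :
    lap μ S f = laplacian μ S f := by
  funext x
  simp [lap, laplacian, avg]

@[simp]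
theorem lap_empty : lap μ (∅ : Finset (Fin n)) = 1 := by
  simp [lap]

theorem lap_singleton (i : Fin n) : lap μ {i} = 1 - avg μ {i} := by
  have : ({i} : Finset (Fin n)) = insert i ∅ := by simp
  rw [lap, this, Finset.sum_powerset_insert (Finset.notMem_empty i)]
  simp only [Finset.powerset_empty, Finset.sum_singleton, Finset.card_empty, pow_zero, avg_empty,
    insert_empty_eq, Finset.card_singleton, pow_one, sub_eq_add_neg, one_smul]
  rw [neg_one_smul ℝ (avg μ {i})]

theorem lap_insert {i : Fin n} {S : Finset (Fin n)} (hi : i ∉ S) :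
    lap μ (insert i S) = lap μ {i} * lap μ S := by
  rw [lap_singleton, sub_mul, one_mul]
  simp only [lap]
  rw [Finset.sum_powerset_insert hi, sub_eq_add_neg, Finset.mul_sum, ← Finset.sum_neg_distrib]
  congr 1
  refine Finset.sum_congr rfl fun T hT => ?_
  have hiT : i ∉ T := fun h => hi (Finset.mem_powerset.1 hT h)
  rw [Finset.card_insert_of_notMem hiT, pow_succ, mul_smul_comm, avg_insert μ hiT, mul_neg_one]
  exact neg_smul ((-1 : ℝ) ^ T.card) (avg μ {i} * avg μ T)

theorem avg_lap_commute (S T : Finset (Fin n)) : Commute (avg μ S) (lap μ T) :=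
  Commute.sum_right _ _ _ fun _ _ => (avg_commute μ _ _).smul_right _

theorem lap_commute (S T : Finset (Fin n)) : Commute (lap μ S) (lap μ T) :=
  Commute.sum_right _ _ _ fun _ _ => ((avg_lap_commute μ _ _).symm).smul_right _

theorem lap_union {S T : Finset (Fin n)} (h : Disjoint S T) :
    lap μ (S ∪ T) = lap μ S * lap μ T := by
  induction S using Finset.induction_on with
  | empty => simp
  | insert i S hi ih =>
    rw [Finset.disjoint_insert_left] at h
    rw [Finset.insert_union, lap_insert μ (by simp [hi, h.1]), ih h.2, lap_insert μ hi, mul_assoc]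

theorem avg_mul_lap_eq_zero {i : Fin n} {S T : Finset (Fin n)} (hS : i ∈ S) (hT : i ∈ T) :
    avg μ S * lap μ T = 0 := by
  have h1 : avg μ S = avg μ S * avg μ {i} := by
    rw [avg_mul]; congr 1; symm; simpa using hS
  rw [← Finset.insert_erase hT, lap_insert μ (Finset.notMem_erase i T), h1, mul_assoc,
    ← mul_assoc (avg μ {i}), lap_singleton, mul_sub, avg_singleton_idem]
  simp

theorem lap_idem (S : Finset (Fin n)) : lap μ S * lap μ S = lap μ S := by
  induction S using Finset.induction_on with
  | empty => simp
  | insert i S hi ih =>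
    have h : lap μ {i} * lap μ {i} = lap μ {i} := by
      simp [lap_singleton, mul_sub, sub_mul, avg_singleton_idem]
    rw [lap_insert μ hi, (lap_commute μ S {i}).mul_mul_mul_comm, ih, h]

theorem avg_lap_mul {S T : Finset (Fin n)} (h : T ⊆ S) (u v : (Fin n → Ω) → ℝ) :
    avg μ S (lap μ T u * v) = avg μ S (u * lap μ T v) := by
  simp only [lap, LinearMap.sum_apply, LinearMap.smul_apply, Finset.sum_mul, Finset.mul_sum,
    smul_mul_assoc, mul_smul_comm, map_sum, map_smul]
  refine Finset.sum_congr rfl fun A hA => ?_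
  rw [avg_mul_avg μ ((Finset.mem_powerset.1 hA).trans h)]

/-- The projection onto the Efron–Stein component at `U`. -/
noncomputable def component (U : Finset (Fin n)) :
    ((Fin n → Ω) → ℝ) →ₗ[ℝ] ((Fin n → Ω) → ℝ) :=
  avg μ Uᶜ * lap μ U

theorem component_eq_efronStein (U : Finset (Fin n)) (f : (Fin n → Ω) → ℝ) :
    component μ U f = efronStein μ U f := by
  rw [component, Module.End.mul_apply, lap_eq_laplacian]; rfl

/-- If U ≠ T, a coordinate lying in exactly one of them meets an averaging from one factor and a
Laplacian from the other, and E_i L_i = 0. -/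
theorem component_mul (U T : Finset (Fin n)) :
    component μ U * component μ T = if U = T then component μ U else 0 := by
  simp only [component]
  rw [(avg_lap_commute μ Tᶜ U).symm.mul_mul_mul_comm]
  split_ifs with h
  · subst h
    rw [avg_mul, lap_idem, Finset.union_idempotent]
  · obtain ⟨i, hi⟩ : ∃ i, ¬ (i ∈ U ↔ i ∈ T) := by
      by_contra! H
      exact h (Finset.ext H)
    rw [avg_mul]
    by_cases hU : i ∈ U
    · have hT : i ∉ T := fun h => hi (by simp [hU, h])
      rw [← mul_assoc, avg_mul_lap_eq_zero μ (i := i) (by simp [hT]) hU, zero_mul]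
    · have hT : i ∈ T := by by_contra h; exact hi (by simp [hU, h])
      rw [(lap_commute μ U T).eq, ← mul_assoc, avg_mul_lap_eq_zero μ (i := i) (by simp [hU]) hT,
        zero_mul]

/-- The quadratic form of the Hilbert space norm in which the coordinates in `G` have been replaced
by Gaussian variables of variance `b`. -/
noncomputable def gaussForm (b : ℝ) (G : Finset (Fin n)) (u v : (Fin n → Ω) → ℝ) :
    (Fin n → Ω) → ℝ :=
  ∑ T ∈ G.powerset, b ^ T.card • avg μ G (lap μ T (avg μ (G \ T) u) * lap μ T (avg μ (G \ T) v))

theorem gaussForm_self_nonneg {b : ℝ} (hb : 0 ≤ b) (G : Finset (Fin n)) (u : (Fin n → Ω) → ℝ) :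
    0 ≤ gaussForm μ b G u u :=
  Finset.sum_nonneg fun _ _ =>
    smul_nonneg (pow_nonneg hb _) (avg_nonneg μ _ fun _ => mul_self_nonneg _)

theorem gaussForm_add_self (b : ℝ) (G : Finset (Fin n)) (u v : (Fin n → Ω) → ℝ) :
    gaussForm μ b G (u + v) (u + v)
      = gaussForm μ b G u u + 2 * gaussForm μ b G u v + gaussForm μ b G v v := by
  simp only [gaussForm, Finset.mul_sum, ← Finset.sum_add_distrib]
  refine Finset.sum_congr rfl fun T _ => ?_
  rw [mul_smul_comm, ← smul_add, ← smul_add]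
  congr 1
  simp only [map_add, mul_add, add_mul, mul_comm (lap μ T (avg μ (G \ T) v))]
  ring

theorem sq_gaussForm_le {b : ℝ} (hb : 0 ≤ b) (G : Finset (Fin n)) (u v : (Fin n → Ω) → ℝ)
    (x : Fin n → Ω) :
    gaussForm μ b G u v x ^ 2 ≤ gaussForm μ b G u u x * gaussForm μ b G v v x := by
  simp only [gaussForm, Finset.sum_apply, Pi.smul_apply, smul_eq_mul]
  refine Finset.sum_sq_le_sum_mul_sum_of_sq_le_mul _
    (fun _ _ => mul_nonneg (pow_nonneg hb _) (avg_nonneg μ _ (fun _ => mul_self_nonneg _) x))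
    (fun _ _ => mul_nonneg (pow_nonneg hb _) (avg_nonneg μ _ (fun _ => mul_self_nonneg _) x))
    fun T _ => ?_
  have h := sq_avg_mul_le μ G (lap μ T (avg μ (G \ T) u)) (lap μ T (avg μ (G \ T) v)) x
  rw [sq (lap μ T (avg μ (G \ T) u)), sq (lap μ T (avg μ (G \ T) v))] at h
  have hb2 : 0 ≤ (b ^ T.card) ^ 2 := sq_nonneg _
  nlinarith [mul_le_mul_of_nonneg_left h hb2]

theorem avg_gaussForm {i : Fin n} (b : ℝ) (G : Finset (Fin n)) {u : (Fin n → Ω) → ℝ}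
    (hu : avg μ {i} u = u) (v : (Fin n → Ω) → ℝ) :
    avg μ {i} (gaussForm μ b G u v) = gaussForm μ b G u (avg μ {i} v) := by
  simp only [gaussForm, map_sum, map_smul]
  refine Finset.sum_congr rfl fun T _ => ?_
  have hc : ∀ w, avg μ {i} (lap μ T (avg μ (G \ T) w)) = lap μ T (avg μ (G \ T) (avg μ {i} w)) := by
    intro w
    simp only [← Module.End.mul_apply]
    rw [← mul_assoc, (avg_lap_commute μ {i} T).eq, mul_assoc, (avg_commute μ {i} _).eq]
  rw [← Module.End.mul_apply, (avg_commute μ {i} G).eq, Module.End.mul_apply,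
    avg_mul_of_avg_eq μ (by rw [hc, hu]), hc]

/-- The subsets T avoiding i see only the mean E_i u; those containing i see L_i u, with one extra
factor b. -/
theorem gaussForm_insert (b : ℝ) {i : Fin n} {G : Finset (Fin n)} (hi : i ∉ G)
    (u : (Fin n → Ω) → ℝ) :
    gaussForm μ b (insert i G) u u
      = gaussForm μ b G (avg μ {i} u) (avg μ {i} u)
        + b • avg μ {i} (gaussForm μ b G (lap μ {i} u) (lap μ {i} u)) := by
  simp only [gaussForm]
  rw [Finset.sum_powerset_insert hi, map_sum, Finset.smul_sum]
  congr 1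
  · refine Finset.sum_congr rfl fun T hT => ?_
    have hiT : i ∉ T := fun h => hi (Finset.mem_powerset.1 hT h)
    have hi' : i ∉ G \ T := fun h => hi (Finset.mem_sdiff.1 h).1
    rw [Finset.insert_sdiff_of_notMem _ hiT, avg_insert_eq_mul μ hi', avg_insert_eq_mul μ hi,
      Module.End.mul_apply, Module.End.mul_apply]
    congr 2
    have h : avg μ {i} (lap μ T (avg μ (G \ T) (avg μ {i} u)))
        = lap μ T (avg μ (G \ T) (avg μ {i} u)) := by
      simp only [← Module.End.mul_apply]
      rw [← mul_assoc, (avg_lap_commute μ {i} T).eq, mul_assoc, ← avg_insert_eq_mul μ hi',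
        avg_singleton_mul, Finset.insert_idem]
    exact avg_mul_eq μ h h
  · refine Finset.sum_congr rfl fun T hT => ?_
    have hiT : i ∉ T := fun h => hi (Finset.mem_powerset.1 hT h)
    have h1 : insert i G \ insert i T = G \ T := by
      ext j; by_cases hj : j = i <;> simp [hj, hi]
    have h2 : lap μ (insert i T) (avg μ (G \ T) u) = lap μ T (avg μ (G \ T) (lap μ {i} u)) := by
      simp only [← Module.End.mul_apply]
      rw [lap_insert μ hiT, (lap_commute μ {i} T).eq, mul_assoc, ← (avg_lap_commute μ _ {i}).eq]
    rw [h1, h2, Finset.card_insert_of_notMem hiT, avg_insert μ hi, pow_succ', mul_smul,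
      map_smul, Module.End.mul_apply]

/-- Replacing one more coordinate by a Gaussian variable, at the cost of a Laplacian term. -/
theorem avg_gaussForm_pow_le {m : ℕ} (hm : 1 ≤ m) {i : Fin n} {G : Finset (Fin n)} (hi : i ∉ G)
    (u : (Fin n → Ω) → ℝ) :
    avg μ {i} (gaussForm μ (7 * m) G u u ^ m)
      ≤ gaussForm μ (7 * m) (insert i G) u u ^ m
        + (16 * (m : ℝ) ^ 2) ^ m • avg μ {i} (gaussForm μ (7 * m) G (lap μ {i} u) (lap μ {i} u) ^ m) := by
  have hb : (0 : ℝ) ≤ 7 * m := by positivity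
  set A := gaussForm μ (7 * m) G (avg μ {i} u) (avg μ {i} u) with hA
  set W := gaussForm μ (7 * m) G (avg μ {i} u) (lap μ {i} u) with hW
  set V := gaussForm μ (7 * m) G (lap μ {i} u) (lap μ {i} u) with hV
  have hid : avg μ {i} (avg μ {i} u) = avg μ {i} u := by
    rw [← Module.End.mul_apply, avg_singleton_idem]
  have hzero : avg μ {i} (lap μ {i} u) = 0 := by
    rw [← Module.End.mul_apply, avg_mul_lap_eq_zero μ (i := i) (by simp) (by simp)]; simp
  have hdec : gaussForm μ (7 * m) G u u = A + 2 * W + V := by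
    rw [hA, hW, hV, ← gaussForm_add_self, lap_singleton]
    simp
  have hAi : avg μ {i} A = A := by rw [hA, avg_gaussForm μ _ _ hid, hid]
  -- The cross term is linear in L_i u, which has mean zero in coordinate i.
  have hWi : avg μ {i} W = 0 := by
    rw [hW, avg_gaussForm μ _ _ hid, hzero]; simp [gaussForm]
  have hA0 : 0 ≤ A := gaussForm_self_nonneg μ hb _ _
  have hV0 : 0 ≤ V := gaussForm_self_nonneg μ hb _ _
  have hVi0 : 0 ≤ avg μ {i} V := avg_nonneg μ _ hV0
  have hpt : (A + 2 * W + V) ^ m ≤ A ^ m + (2 * m : ℝ) • (A ^ (m - 1) * W)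
      + (7 * (m : ℝ) ^ 2) • (A ^ (m - 1) * V) + (16 * (m : ℝ) ^ 2) ^ m • V ^ m := fun x => by
    simpa using pow_add_le m hm (hA0 x) (hV0 x) (sq_gaussForm_le μ hb G _ _ x)
  have havg := avg_mono μ {i} hpt
  rw [map_add, map_add, map_add, map_smul, map_smul, map_smul, avg_pow_eq μ hAi,
    avg_mul_of_avg_eq μ (avg_pow_eq μ hAi _), avg_mul_of_avg_eq μ (avg_pow_eq μ hAi _), hWi] at havg
  rw [hdec, gaussForm_insert μ _ hi, ← hA, ← hV]
  refine havg.trans (add_le_add_left ?_ _)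
  intro x
  have hx := hA0 x
  have hy := hVi0 x
  simp only [Pi.zero_apply] at hx hy
  simp only [Pi.add_apply, Pi.smul_apply, Pi.pow_apply, Pi.mul_apply, Pi.zero_apply, smul_eq_mul]
  -- Bernoulli's inequality: the variance 7m is chosen so that m · 7m matches the coefficient 7m² of
  -- A^(m-1) V.
  have hB : A x ^ m + m * A x ^ (m - 1) * (7 * m * avg μ {i} V x)
      ≤ (A x + 7 * m * avg μ {i} V x) ^ m :=
    pow_add_mul_le_add_pow_of_sq_nonneg hx (sq_nonneg _) (sq_nonneg _) (by positivity) m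
  nlinarith

/-- A moment bound in terms of all the Laplacians. -/
theorem avg_pow_le_sum {m : ℕ} (hm : 1 ≤ m) (R : Finset (Fin n)) (u : (Fin n → Ω) → ℝ) :
    avg μ R (u ^ (2 * m))
      ≤ ∑ S ∈ R.powerset, ((16 * (m : ℝ) ^ 2) ^ m) ^ S.card •
          avg μ S (gaussForm μ (7 * m) (R \ S) (lap μ S u) (lap μ S u) ^ m) := by
  -- S records the coordinates where the Laplacian term was taken, R \ S those replaced by
  -- Gaussians.
  induction R using Finset.induction_on with
  | empty => simp [gaussForm, pow_mul, sq]
  | insert i R hi ih =>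
    rw [avg_insert μ hi, Module.End.mul_apply, Finset.sum_powerset_insert hi]
    refine (avg_mono μ {i} ih).trans ?_
    rw [map_sum, ← Finset.sum_add_distrib]
    refine Finset.sum_le_sum fun S hS => ?_
    have hiS : i ∉ S := fun h => hi (Finset.mem_powerset.1 hS h)
    have hi' : i ∉ R \ S := fun h => hi (Finset.mem_sdiff.1 h).1
    have h1 : insert i R \ insert i S = R \ S := by
      ext j; by_cases hj : j = i <;> simp [hj, hi]
    rw [map_smul, ← Module.End.mul_apply, (avg_commute μ {i} S).eq, Module.End.mul_apply,
      Finset.insert_sdiff_of_notMem _ hiS, h1, Finset.card_insert_of_notMem hiS, pow_succ _ S.card,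
      avg_insert_eq_mul μ hiS, lap_insert μ hiS, mul_smul, Module.End.mul_apply,
      Module.End.mul_apply, ← smul_add]
    have h := avg_mono μ S (avg_gaussForm_pow_le μ hm hi' (lap μ S u))
    rw [map_add, map_smul] at h
    exact smul_le_smul_of_nonneg_left h (by positivity)

end Operators

/-! ### Level weights and conditional hypercontractivity -/

section Levels

variable {n : ℕ} {Ω : Type*} [Fintype Ω] [MeasurableSpace Ω] [MeasurableSingletonClass Ω]
  (μ : Measure Ω) [IsProbabilityMeasure μ]

/-- The sets of size `d` that contain `S`. -/
def supersets (d : ℕ) (S : Finset (Fin n)) : Finset (Finset (Fin n)) :=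
  (Finset.powersetCard d Finset.univ).filter (S ⊆ ·)

theorem mem_supersets {d : ℕ} {S U : Finset (Fin n)} :
    U ∈ supersets d S ↔ U.card = d ∧ S ⊆ U := by
  simp [supersets, Finset.mem_powersetCard]

/-- The part of level `d` of `f` carried by the sets containing `S`. -/
noncomputable def levelAbove (d : ℕ) (S : Finset (Fin n)) (f : (Fin n → Ω) → ℝ) :
    (Fin n → Ω) → ℝ :=
  ∑ U ∈ supersets d S, component μ U f

/-- The squared norm of the level `d - |S|` part of the derivative of `f` at `S`. -/
noncomputable def weightAbove (d : ℕ) (S : Finset (Fin n)) (f : (Fin n → Ω) → ℝ) :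
    (Fin n → Ω) → ℝ :=
  ∑ U ∈ supersets d S, avg μ Sᶜ (component μ U f ^ 2)

theorem weightAbove_nonneg (d : ℕ) (S : Finset (Fin n)) (f : (Fin n → Ω) → ℝ) :
    0 ≤ weightAbove μ d S f :=
  Finset.sum_nonneg fun _ _ => avg_nonneg μ _ fun _ => sq_nonneg _

theorem levelAbove_empty (d : ℕ) (f : (Fin n → Ω) → ℝ) :
    levelAbove μ d ∅ f = levelPart μ d f := by
  funext x
  simp [levelAbove, supersets, levelPart, component_eq_efronStein]

theorem component_component (U T : Finset (Fin n)) (f : (Fin n → Ω) → ℝ) :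
    component μ U (component μ T f) = if U = T then component μ U f else 0 := by
  rw [← Module.End.mul_apply, component_mul]
  split_ifs <;> simp

theorem component_levelAbove (d : ℕ) (S U : Finset (Fin n)) (f : (Fin n → Ω) → ℝ) :
    component μ U (levelAbove μ d S f) = if U ∈ supersets d S then component μ U f else 0 := by
  simp [levelAbove, component_component]

theorem weightAbove_levelAbove (d : ℕ) (S : Finset (Fin n)) (f : (Fin n → Ω) → ℝ) :
    weightAbove μ d S (levelAbove μ d S f) = weightAbove μ d S f := by
  refine Finset.sum_congr rfl fun U hU => ?_
  rw [component_levelAbove, if_pos hU]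

theorem levelAbove_levelAbove (d : ℕ) (S : Finset (Fin n)) (f : (Fin n → Ω) → ℝ) :
    levelAbove μ d S (levelAbove μ d S f) = levelAbove μ d S f := by
  refine Finset.sum_congr rfl fun U hU => ?_
  rw [component_levelAbove, if_pos hU]

theorem lap_component {S U : Finset (Fin n)} (h : S ⊆ U) (f : (Fin n → Ω) → ℝ) :
    lap μ S (component μ U f) = component μ U f := by
  have hU : lap μ U = lap μ S * lap μ (U \ S) := by
    rw [← lap_union μ Finset.disjoint_sdiff, Finset.union_sdiff_of_subset h]
  rw [← Module.End.mul_apply, component, ← mul_assoc, ← (avg_lap_commute μ Uᶜ S).eq, hU,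
    mul_assoc, ← mul_assoc (lap μ S), lap_idem]

theorem avg_compl_component (U : Finset (Fin n)) (f : (Fin n → Ω) → ℝ) :
    avg μ Uᶜ (component μ U f) = component μ U f := by
  rw [← Module.End.mul_apply, component, ← mul_assoc, avg_mul, Finset.union_idempotent]

/-- Since S ⊆ U, the operators that turn L_S f into f^{=U} act only on Sᶜ. They move across the
product by self-adjointness and fix the other factor. -/
theorem avg_sq_component {S U : Finset (Fin n)} (h : S ⊆ U) (f : (Fin n → Ω) → ℝ) :
    avg μ Sᶜ (component μ U f ^ 2) = avg μ Sᶜ (lap μ S f * component μ U f) := by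
  have hU : component μ U f = avg μ Uᶜ (lap μ (U \ S) (lap μ S f)) := by
    simp only [← Module.End.mul_apply]
    rw [← lap_union μ Finset.sdiff_disjoint, Finset.sdiff_union_of_subset h, component]
  have hsub : U \ S ⊆ Sᶜ := fun i hi => by simpa using (Finset.mem_sdiff.1 hi).2
  rw [sq]
  nth_rw 1 [hU]
  rw [avg_mul_avg μ (Finset.compl_subset_compl.2 h), avg_compl_component,
    avg_lap_mul μ hsub, lap_component μ Finset.sdiff_subset]

theorem weightAbove_eq (d : ℕ) (S : Finset (Fin n)) (f : (Fin n → Ω) → ℝ) :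
    weightAbove μ d S f = avg μ Sᶜ (lap μ S f * levelAbove μ d S f) := by
  rw [weightAbove, levelAbove, Finset.mul_sum, map_sum]
  exact Finset.sum_congr rfl fun U hU => avg_sq_component μ (mem_supersets.1 hU).2 f

theorem l2Norm_levelPart_sq (d : ℕ) (f : (Fin n → Ω) → ℝ) (x : Fin n → Ω) :
    l2Norm μ (levelPart μ d f) ^ 2 = weightAbove μ d ∅ f x := by
  have h0 : 0 ≤ expect μ fun x => levelPart μ d f x ^ 2 := by
    have := expect_mono μ (g := fun _ => 0) (h := fun x => levelPart μ d f x ^ 2)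
      fun x => sq_nonneg _
    rwa [expect_const] at this
  rw [l2Norm, Real.sq_sqrt h0, ← weightAbove_levelAbove, weightAbove_eq, levelAbove_levelAbove,
    lap_empty, Finset.compl_empty, avg_univ_apply, levelAbove_empty]
  simp [sq, Pi.mul_def]

/-- The term at T isolates the component at T ∪ S₀ ∪ S. Homogeneity of degree d forces |T| = d - |S₀
∪ S|, so the power of b is a common factor. -/
theorem gaussForm_lap_levelAbove (b : ℝ) (d : ℕ) {S₀ S : Finset (Fin n)} (hS : S ⊆ S₀ᶜ)
    (f : (Fin n → Ω) → ℝ) :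
    gaussForm μ b (S₀ᶜ \ S) (lap μ S (levelAbove μ d S₀ f)) (lap μ S (levelAbove μ d S₀ f))
      = b ^ (d - (S₀ ∪ S).card) • weightAbove μ d (S₀ ∪ S) f := by
  have hG : S₀ᶜ \ S = (S₀ ∪ S)ᶜ := by
    ext i; simp
  have hdis : Disjoint S₀ S := by
    rw [Finset.disjoint_left]
    intro i hi hi'
    exact (Finset.mem_compl.1 (hS hi')) hi
  have hlev : lap μ S (levelAbove μ d S₀ f) = lap μ (S ∪ S₀) (levelAbove μ d S₀ f) := by
    rw [lap_union μ hdis.symm, Module.End.mul_apply]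
    congr 1
    rw [levelAbove, map_sum]
    exact Finset.sum_congr rfl fun U hU => (lap_component μ (mem_supersets.1 hU).2 f).symm
  rw [hG, hlev, Finset.union_comm S S₀]
  set S' := S₀ ∪ S with hS'
  rw [gaussForm, weightAbove, Finset.smul_sum]
  have hterm : ∀ T ∈ S'ᶜ.powerset,
      lap μ T (avg μ (S'ᶜ \ T) (lap μ S' (levelAbove μ d S₀ f)))
        = if T ∪ S' ∈ supersets d S₀ then component μ (T ∪ S') f else 0 := by
    intro T hT
    have hd : Disjoint T S' := by
      rw [Finset.disjoint_left]
      intro i hi hi'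
      exact (Finset.mem_compl.1 (Finset.mem_powerset.1 hT hi)) hi'
    have hc : S'ᶜ \ T = (T ∪ S')ᶜ := by
      ext i; simp [and_comm]
    rw [← component_levelAbove, component, lap_union μ hd, hc]
    simp only [← Module.End.mul_apply]
    rw [← mul_assoc, ← mul_assoc, (avg_lap_commute μ _ T).eq]
  have hsum : ∀ T ∈ S'ᶜ.powerset,
      b ^ T.card • avg μ S'ᶜ (lap μ T (avg μ (S'ᶜ \ T) (lap μ S' (levelAbove μ d S₀ f)))
          * lap μ T (avg μ (S'ᶜ \ T) (lap μ S' (levelAbove μ d S₀ f))))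
        = if T ∪ S' ∈ supersets d S' then
            b ^ (d - S'.card) • avg μ S'ᶜ (component μ (T ∪ S') f ^ 2) else 0 := by
    intro T hT
    have hd : Disjoint T S' := by
      rw [Finset.disjoint_left]
      intro i hi hi'
      exact (Finset.mem_compl.1 (Finset.mem_powerset.1 hT hi)) hi'
    have hiff : T ∪ S' ∈ supersets d S₀ ↔ T ∪ S' ∈ supersets d S' := by
      rw [mem_supersets, mem_supersets]
      have h1 : S₀ ⊆ T ∪ S' := Finset.subset_union_left.trans Finset.subset_union_right
      simp [h1]
    rw [hterm T hT]
    by_cases h : T ∪ S' ∈ supersets d S'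
    · have hcard : T.card = d - S'.card := by
        have := (mem_supersets.1 h).1
        rw [Finset.card_union_of_disjoint hd] at this
        omega
      rw [if_pos h, if_pos (hiff.2 h), hcard, sq]
    · rw [if_neg h, if_neg (fun h' => h (hiff.1 h'))]
      simp
  rw [Finset.sum_congr rfl hsum, ← Finset.sum_filter]
  refine Finset.sum_bij' (fun T _ => T ∪ S') (fun U _ => U \ S') ?_ ?_ ?_ ?_ ?_
  · intro T hT
    exact (Finset.mem_filter.1 hT).2
  · intro U hU
    have hsub := (mem_supersets.1 hU).2
    rw [Finset.mem_filter, Finset.sdiff_union_of_subset hsub, Finset.mem_powerset]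
    exact ⟨fun i hi => by simpa using (Finset.mem_sdiff.1 hi).2, hU⟩
  · intro T hT
    have hd : Disjoint T S' := by
      rw [Finset.disjoint_left]
      intro i hi hi'
      exact (Finset.mem_compl.1 (Finset.mem_powerset.1 (Finset.mem_filter.1 hT).1 hi)) hi'
    rw [Finset.union_sdiff_right, Finset.sdiff_eq_self_of_disjoint hd]
  · intro U hU
    exact Finset.sdiff_union_of_subset (mem_supersets.1 hU).2
  · intro T hT
    rfl

/-- The moments of the level `d` part in terms of the weights of all derivatives. -/
theorem avg_levelAbove_pow_le {m : ℕ} (hm : 1 ≤ m) (d : ℕ) (S₀ : Finset (Fin n))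
    (f : (Fin n → Ω) → ℝ) :
    avg μ S₀ᶜ (levelAbove μ d S₀ f ^ (2 * m))
      ≤ ∑ S ∈ S₀ᶜ.powerset, (((16 * (m : ℝ) ^ 2) ^ m) ^ S.card
          * ((7 * (m : ℝ)) ^ m) ^ (d - (S₀ ∪ S).card)) •
          avg μ S (weightAbove μ d (S₀ ∪ S) f ^ m) := by
  refine (avg_pow_le_sum μ hm S₀ᶜ _).trans (le_of_eq (Finset.sum_congr rfl fun S hS => ?_))
  rw [gaussForm_lap_levelAbove μ _ d (Finset.mem_powerset.1 hS), smul_pow, map_smul, mul_smul,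
    ← pow_mul, ← pow_mul, ← pow_mul, mul_comm m (d - _)]

theorem avg_weightAbove (d : ℕ) (S₀ S : Finset (Fin n)) (hS : S ⊆ S₀ᶜ) (f : (Fin n → Ω) → ℝ) :
    avg μ S (weightAbove μ d (S₀ ∪ S) f)
      = ∑ U ∈ (supersets d S₀).filter (S ⊆ ·), avg μ S₀ᶜ (component μ U f ^ 2) := by
  have h1 : supersets d (S₀ ∪ S) = (supersets d S₀).filter (S ⊆ ·) := by
    ext U
    simp only [mem_supersets, Finset.mem_filter, Finset.union_subset_iff, and_assoc]
  have h2 : S ∪ (S₀ ∪ S)ᶜ = S₀ᶜ := by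
    ext i
    have := @hS i
    simp only [Finset.mem_union, Finset.mem_compl] at this ⊢
    tauto
  rw [weightAbove, map_sum, h1]
  exact Finset.sum_congr rfl fun U _ => by rw [avg_avg, h2]

/-- If the weights of the derivatives decay geometrically, the level `d` part satisfies a
hypercontractive moment bound. -/
theorem avg_levelAbove_pow_le_weightAbove {m : ℕ} (hm : 1 ≤ m) (d : ℕ) (S₀ : Finset (Fin n))
    (f : (Fin n → Ω) → ℝ) {θ : ℝ} (x : Fin n → Ω)
    (hdec : ∀ S ⊆ S₀ᶜ, S.Nonempty → ∀ y,
      weightAbove μ d (S₀ ∪ S) f y ≤ θ ^ S.card * weightAbove μ d S₀ f x) :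
    avg μ S₀ᶜ (levelAbove μ d S₀ f ^ (2 * m)) x
      ≤ ((7 * (m : ℝ)) ^ m + (16 * (m : ℝ) ^ 2) ^ m * θ ^ (m - 1)) ^ (d - S₀.card)
        * weightAbove μ d S₀ f x ^ m := by
  set w := weightAbove μ d S₀ f x with hw
  have hw0 : 0 ≤ w := weightAbove_nonneg μ d S₀ f x
  set κ : ℝ := (16 * (m : ℝ) ^ 2) ^ m with hκ
  set b : ℝ := (7 * (m : ℝ)) ^ m with hb
  have hκ0 : 0 ≤ κ := by positivity
  have hb0 : 0 ≤ b := by positivity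
  have hmm : m - 1 + 1 = m := by omega
  -- Decay is spent on m - 1 of the m powers; the last stays exact so that it can be expanded over
  -- components.
  have hpow : ∀ S ∈ S₀ᶜ.powerset, avg μ S (weightAbove μ d (S₀ ∪ S) f ^ m) x
      ≤ (θ ^ S.card * w) ^ (m - 1) * avg μ S (weightAbove μ d (S₀ ∪ S) f) x := by
    intro S hS
    rcases S.eq_empty_or_nonempty with rfl | hne
    · simp [← hw, ← pow_succ, hmm]
    · have h := avg_mono μ S (f := weightAbove μ d (S₀ ∪ S) f ^ m)
        (g := (θ ^ S.card * w) ^ (m - 1) • weightAbove μ d (S₀ ∪ S) f) fun y => by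
          simp only [Pi.pow_apply, Pi.smul_apply, smul_eq_mul]
          have h0 := weightAbove_nonneg μ d (S₀ ∪ S) f y
          rw [← hmm, pow_succ, hmm]
          exact mul_le_mul_of_nonneg_right
            (pow_le_pow_left₀ h0 (hdec S (Finset.mem_powerset.1 hS) hne y) _) h0
      rw [map_smul] at h
      exact h x
  have h := avg_levelAbove_pow_le μ hm d S₀ f x
  simp only [Finset.sum_apply, Pi.smul_apply, smul_eq_mul] at h
  calc avg μ S₀ᶜ (levelAbove μ d S₀ f ^ (2 * m)) x
      ≤ ∑ S ∈ S₀ᶜ.powerset, (κ ^ S.card * b ^ (d - (S₀ ∪ S).card)) *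
          avg μ S (weightAbove μ d (S₀ ∪ S) f ^ m) x := h
    _ ≤ ∑ S ∈ S₀ᶜ.powerset, (κ ^ S.card * b ^ (d - (S₀ ∪ S).card)) *
          ((θ ^ S.card * w) ^ (m - 1) * avg μ S (weightAbove μ d (S₀ ∪ S) f) x) :=
        Finset.sum_le_sum fun S hS => mul_le_mul_of_nonneg_left (hpow S hS) (by positivity)
    _ = ∑ S ∈ S₀ᶜ.powerset, ∑ U ∈ (supersets d S₀).filter (S ⊆ ·),
          w ^ (m - 1) * ((κ * θ ^ (m - 1)) ^ S.card * b ^ ((U \ S₀).card - S.card))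
            * avg μ S₀ᶜ (component μ U f ^ 2) x := by
        refine Finset.sum_congr rfl fun S hS => ?_
        have hS' := Finset.mem_powerset.1 hS
        rw [avg_weightAbove μ d S₀ S hS', Finset.sum_apply, Finset.mul_sum, Finset.mul_sum]
        refine Finset.sum_congr rfl fun U hU => ?_
        have hU' := mem_supersets.1 (Finset.mem_filter.1 hU).1
        have hd : Disjoint S₀ S := by
          rw [Finset.disjoint_left]
          intro i hi hi'
          exact (Finset.mem_compl.1 (hS' hi')) hi
        have hc : (U \ S₀).card - S.card = d - (S₀ ∪ S).card := by
          rw [Finset.card_sdiff_of_subset hU'.2, hU'.1, Finset.card_union_of_disjoint hd]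
          omega
        rw [hc, mul_pow κ, mul_pow (θ ^ S.card), pow_right_comm θ S.card]
        ring
    _ = ∑ U ∈ supersets d S₀, ∑ S ∈ (U \ S₀).powerset,
          w ^ (m - 1) * ((κ * θ ^ (m - 1)) ^ S.card * b ^ ((U \ S₀).card - S.card))
            * avg μ S₀ᶜ (component μ U f ^ 2) x := by
        refine Finset.sum_comm' fun S U => ?_
        simp only [Finset.mem_powerset, Finset.mem_filter, Finset.subset_iff, Finset.mem_compl,
          Finset.mem_sdiff]
        constructor
        · rintro ⟨h1, h2, h3⟩
          exact ⟨fun i hi => ⟨h3 hi, h1 hi⟩, h2⟩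
        · rintro ⟨h1, h2⟩
          exact ⟨fun i hi => (h1 hi).2, h2, fun i hi => (h1 hi).1⟩
    _ = ∑ U ∈ supersets d S₀, w ^ (m - 1) * (b + κ * θ ^ (m - 1)) ^ (d - S₀.card)
            * avg μ S₀ᶜ (component μ U f ^ 2) x := by
        -- For fixed U, the sum over S ⊆ U \ S₀ is a binomial expansion.
        refine Finset.sum_congr rfl fun U hU => ?_
        have hU' := mem_supersets.1 hU
        rw [← Finset.sum_mul, ← Finset.mul_sum, Finset.sum_pow_mul_eq_add_pow,
          Finset.card_sdiff_of_subset hU'.2, hU'.1, add_comm b]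
    _ = (b + κ * θ ^ (m - 1)) ^ (d - S₀.card) * (w ^ (m - 1) * w) := by
        rw [← Finset.mul_sum, hw, weightAbove, Finset.sum_apply]
        ring
    _ = _ := by rw [← pow_succ, hmm]

end Levels

/-! ### Induction on the remaining level -/

section Main

variable {n : ℕ} {Ω : Type*} [Fintype Ω] [MeasurableSpace Ω] [MeasurableSingletonClass Ω]
  (μ : Measure Ω) [IsProbabilityMeasure μ]

/-- Taking k further derivatives shrinks the target bound by at least θ^k; the change of denominator
from j + k to j costs at most exp(k). -/
theorem pow_mul_div_pow_le {ρ L : ℝ} (hρ : 1 ≤ ρ) (hL : 0 < L) (j k : ℕ) (hk : 0 < j + k) :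
    ρ ^ (2 * k) * (550 * ρ ^ 2 * L / j) ^ j
      ≤ (Real.exp 1 / (550 * (L / (j + k : ℕ)))) ^ k * (550 * ρ ^ 2 * L / (j + k : ℕ)) ^ (j + k) := by
  have hjk : (0 : ℝ) < (j + k : ℕ) := by exact_mod_cast hk
  set N : ℝ := ((j + k : ℕ) : ℝ) with hN
  set Y : ℝ := 550 * ρ ^ 2 * L / N with hY
  have hY0 : 0 < Y := by positivity
  have h1 : (550 * ρ ^ 2 * L / j) ^ j ≤ Y ^ j * Real.exp 1 ^ k := by
    rcases Nat.eq_zero_or_pos j with rfl | hj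
    · simp
    · have hj' : (0 : ℝ) < j := by exact_mod_cast hj
      have e1 : 550 * ρ ^ 2 * L / j = Y * (N / j) := by rw [hY]; field_simp
      rw [e1, mul_pow]
      gcongr
      rw [div_pow, div_le_iff₀ (by positivity), mul_comm]
      exact add_pow_le_pow_mul_exp j k
  have e2 : (Real.exp 1 / (550 * (L / N))) * Y = ρ ^ 2 * Real.exp 1 := by
    rw [hY]; field_simp
  calc ρ ^ (2 * k) * (550 * ρ ^ 2 * L / j) ^ j
      ≤ ρ ^ (2 * k) * (Y ^ j * Real.exp 1 ^ k) := by gcongr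
    _ = (ρ ^ 2 * Real.exp 1) ^ k * Y ^ j := by rw [mul_pow, pow_mul]; ring
    _ = _ := by rw [← e2, mul_pow, pow_add]; ring

theorem weightAbove_card_eq (d : ℕ) (S : Finset (Fin n)) (hS : S.card = d)
    (f : (Fin n → Ω) → ℝ) : weightAbove μ d S f = avg μ Sᶜ (lap μ S f) ^ 2 := by
  have h : supersets d S = {S} := by
    ext U
    rw [mem_supersets, Finset.mem_singleton]
    constructor
    · rintro ⟨h1, h2⟩
      exact (Finset.eq_of_subset_of_card_le h2 (by omega)).symm
    · rintro rfl
      exact ⟨hS, subset_rfl⟩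
  rw [weightAbove, h, Finset.sum_singleton, avg_pow_eq μ (avg_compl_component μ S f), component,
    Module.End.mul_apply]

theorem weightAbove_eq_zero (d : ℕ) (S : Finset (Fin n)) (hS : d < S.card)
    (f : (Fin n → Ω) → ℝ) : weightAbove μ d S f = 0 := by
  have h : supersets d S = ∅ := by
    ext U
    simp only [mem_supersets, Finset.notMem_empty, iff_false, not_and]
    intro h1 h2
    have := Finset.card_le_card h2
    omega
  simp [weightAbove, h]

theorem abs_avg_le (S : Finset (Fin n)) (f : (Fin n → Ω) → ℝ) (x : Fin n → Ω) :
    |avg μ S f x| ≤ avg μ S |f| x := by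
  rw [abs_le]
  constructor
  · have := avg_mono μ S (f := -|f|) (g := f) (fun y => neg_abs_le (f y)) x
    rwa [map_neg] at this
  · exact avg_mono μ S (fun y => le_abs_self (f y)) x

/-- The level inequality for all derivatives of a function with small derivatives. -/
theorem weightAbove_le {d : ℕ} {f : (Fin n → Ω) → ℝ} {p ρ : ℝ} (hp : 0 < p) (hρ : 1 ≤ ρ)
    (hd : 4 * (d : ℝ) ≤ Real.log (1 / p))
    (h1 : ∀ S : Finset (Fin n), S.card ≤ d → ∀ x, avg μ Sᶜ |lap μ S f| x ≤ ρ ^ S.card * p)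
    (h2 : ∀ S : Finset (Fin n), S.card ≤ d → ∀ x,
      avg μ Sᶜ (lap μ S f ^ 2) x ≤ ρ ^ (2 * S.card) * p) :
    ∀ (e : ℕ) (S : Finset (Fin n)), S.card + e = d → ∀ x,
      weightAbove μ d S f x
        ≤ ρ ^ (2 * S.card) * p ^ 2 * (550 * ρ ^ 2 * Real.log (1 / p) / e) ^ e := by
  intro e
  induction e using Nat.strong_induction_on with
  | _ e ih =>
  intro S₀ hS₀ x
  have hL : 4 * (e : ℝ) ≤ Real.log (1 / p) := by
    refine le_trans ?_ hd
    have : (e : ℝ) ≤ d := by exact_mod_cast (by omega : e ≤ d)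
    linarith
  set L := Real.log (1 / p) with hLdef
  have hρ0 : 0 < ρ := by linarith
  have hexpL : Real.exp L = p⁻¹ := by rw [hLdef, Real.exp_log (by positivity), one_div]
  rcases Nat.eq_zero_or_pos e with rfl | he
  -- At e = 0 only U = S₀ remains, and the L¹ bound suffices; the last factor is a zeroth power.
  · rw [weightAbove_card_eq μ d S₀ (by omega)]
    have h := (abs_avg_le μ S₀ᶜ (lap μ S₀ f) x).trans (h1 S₀ (by omega) x)
    have h' := pow_le_pow_left₀ (abs_nonneg _) h 2
    rw [sq_abs, mul_pow, ← pow_mul, mul_comm S₀.card] at h'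
    simpa using h'
  by_contra! hlt
  have he0 : (0 : ℝ) < e := by exact_mod_cast he
  have hL0 : 0 < L := by linarith
  set w := weightAbove μ d S₀ f x with hw
  set X := L / e with hX
  have hX4 : 4 ≤ X := by rw [hX, le_div_iff₀ he0]; exact hL
  have hX0 : 0 < X := by linarith
  -- With m ≥ X/2, the factor 1/p = exp(eX) lost in Hölder is at most exp(2m)^e, a constant factor
  -- per level after taking m-th roots.
  set m := ⌈X / 2⌉₊ with hm
  have hm1 : X / 2 ≤ m := Nat.le_ceil _
  have hm2 : (m : ℝ) ≤ 3 / 4 * X := by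
    have := (Nat.ceil_lt_add_one (by positivity : 0 ≤ X / 2)).le
    linarith
  have hm0 : 1 ≤ m := Nat.one_le_iff_ne_zero.2 (Nat.ceil_pos.2 (by positivity)).ne'
  have hmm : m - 1 + 1 = m := by omega
  set θ := Real.exp 1 / (550 * X) with hθ
  set τ := ρ ^ (2 * S₀.card) * p ^ 2 * (550 * ρ ^ 2 * L / e) ^ e with hτ
  have hτ0 : 0 < τ := by positivity
  have hw0 : 0 < w := hτ0.trans hlt
  -- The inductive bound is at most θ^|S| τ, and the negated goal τ < w turns it into decay relative
  -- to w.
  have hdec : ∀ S ⊆ S₀ᶜ, S.Nonempty → ∀ y,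
      weightAbove μ d (S₀ ∪ S) f y ≤ θ ^ S.card * w := by
    intro S hS hne y
    have hdis : Disjoint S₀ S := by
      rw [Finset.disjoint_left]
      intro i hi hi'
      exact (Finset.mem_compl.1 (hS hi')) hi
    have hcard := Finset.card_union_of_disjoint hdis
    have hk := hne.card_pos
    rcases lt_or_ge e S.card with hek | hek
    · rw [weightAbove_eq_zero μ d _ (by omega)]
      exact mul_nonneg (by positivity) hw0.le
    · obtain ⟨j, rfl⟩ : ∃ j, e = j + S.card := ⟨e - S.card, by omega⟩
      have h := ih j (by omega) (S₀ ∪ S) (by omega) y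
      have h' := pow_mul_div_pow_le hρ hL0 j S.card he
      calc weightAbove μ d (S₀ ∪ S) f y
          ≤ ρ ^ (2 * (S₀ ∪ S).card) * p ^ 2 * (550 * ρ ^ 2 * L / j) ^ j := h
        _ = ρ ^ (2 * S₀.card) * p ^ 2
              * (ρ ^ (2 * S.card) * (550 * ρ ^ 2 * L / j) ^ j) := by
            rw [hcard, mul_add, pow_add]; ring
        _ ≤ ρ ^ (2 * S₀.card) * p ^ 2 * (θ ^ S.card
              * (550 * ρ ^ 2 * L / (j + S.card : ℕ)) ^ (j + S.card)) := by gcongr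
        _ = θ ^ S.card * τ := by rw [hτ]; ring
        _ ≤ θ ^ S.card * w := by gcongr
  have hmom := avg_levelAbove_pow_le_weightAbove μ hm0 d S₀ f x hdec
  rw [← hw, show d - S₀.card = e by omega] at hmom
  set Q := (7 * (m : ℝ)) ^ m + (16 * (m : ℝ) ^ 2) ^ m * θ ^ (m - 1) with hQ
  have hQ0 : 0 ≤ Q := by positivity
  have hhol := avg_mul_pow_le μ S₀ᶜ (lap μ S₀ f) (levelAbove μ d S₀ f) hm0 x
  rw [← weightAbove_eq, ← hw] at hhol
  have ha0 : 0 ≤ avg μ S₀ᶜ |lap μ S₀ f| x := avg_nonneg μ _ (abs_nonneg _) x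
  have hc0 : 0 ≤ avg μ S₀ᶜ (levelAbove μ d S₀ f ^ (2 * m)) x :=
    avg_nonneg μ _ (fun y => (even_two_mul m).pow_nonneg _) x
  have hmain : w ^ (2 * m) ≤ (ρ ^ S₀.card * p) ^ (2 * (m - 1)) * (ρ ^ (2 * S₀.card) * p)
      * (Q ^ e * w ^ m) := by
    refine hhol.trans ?_
    have hb0 : 0 ≤ avg μ S₀ᶜ (lap μ S₀ f ^ 2) x := avg_nonneg μ _ (fun _ => sq_nonneg _) x
    gcongr
    · exact h1 S₀ (by omega) x
    · exact h2 S₀ (by omega) x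
  have hwm : w ^ m ≤ (ρ ^ S₀.card * p) ^ (2 * (m - 1)) * (ρ ^ (2 * S₀.card) * p) * Q ^ e := by
    rw [two_mul, pow_add, ← mul_assoc] at hmain
    exact le_of_mul_le_mul_right hmain (pow_pos hw0 m)
  have hprod : (ρ ^ S₀.card * p) ^ (2 * (m - 1)) * (ρ ^ (2 * S₀.card) * p)
      = (ρ ^ (2 * S₀.card) * p ^ 2) ^ m * p⁻¹ := by
    have hsucc : (ρ ^ (2 * S₀.card) * p ^ 2) ^ m
        = (ρ ^ (2 * S₀.card) * p ^ 2) ^ (m - 1) * (ρ ^ (2 * S₀.card) * p ^ 2) := by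
      rw [← pow_succ, hmm]
    rw [hsucc, pow_mul, mul_pow, ← pow_mul, mul_comm S₀.card]
    field_simp
  have hpe : p⁻¹ ≤ (Real.exp 2 ^ m) ^ e := by
    rw [← hexpL, ← Real.exp_nat_mul, ← Real.exp_nat_mul, Real.exp_le_exp]
    have : L = e * X := by rw [hX]; field_simp
    rw [this]
    gcongr
    linarith
  have hfin : w ^ m ≤ τ ^ m := by
    calc w ^ m ≤ (ρ ^ (2 * S₀.card) * p ^ 2) ^ m * p⁻¹ * Q ^ e := by rw [← hprod]; exact hwm
      _ ≤ (ρ ^ (2 * S₀.card) * p ^ 2) ^ m * (Real.exp 2 ^ m) ^ e * Q ^ e := by gcongr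
      _ = (ρ ^ (2 * S₀.card) * p ^ 2) ^ m * (Real.exp 2 ^ m * Q) ^ e := by
          rw [mul_pow (Real.exp 2 ^ m)]; ring
      _ ≤ (ρ ^ (2 * S₀.card) * p ^ 2) ^ m * ((550 * X) ^ m) ^ e := by
          gcongr
          exact exp_mul_add_le hX4 hm1 hm2
      _ ≤ (ρ ^ (2 * S₀.card) * p ^ 2) ^ m * ((550 * ρ ^ 2 * L / e) ^ m) ^ e := by
          gcongr
          rw [hX, ← mul_div_assoc]
          gcongr
          nlinarith
      _ = τ ^ m := by rw [hτ, mul_pow _ ((550 * ρ ^ 2 * L / e) ^ e), pow_right_comm]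
  exact absurd hfin (not_le.2 (pow_lt_pow_left₀ hlt hτ0.le (by omega)))

theorem abs_lap_le {f : (Fin n → Ω) → ℝ} (hf : 0 ≤ f) (S : Finset (Fin n)) :
    |lap μ S f| ≤ ∑ T ∈ S.powerset, avg μ T f := by
  intro x
  simp only [lap, Pi.abs_apply, LinearMap.sum_apply, LinearMap.smul_apply, Finset.sum_apply,
    Pi.smul_apply, smul_eq_mul]
  refine (Finset.abs_sum_le_sum_abs _ _).trans (Finset.sum_le_sum fun T _ => ?_)
  rw [abs_mul, abs_pow, abs_neg, abs_one, one_pow, one_mul, abs_of_nonneg (avg_nonneg μ T hf x)]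

/-- E_{Sᶜ} E_T averages outside S \ T, so globalness bounds each term by r^|S \ T| p, and the
binomial theorem sums them. -/
theorem avg_abs_lap_le {f : (Fin n → Ω) → ℝ} (hf : 0 ≤ f) {r p : ℝ} {d : ℕ}
    (hglobal : ∀ S : Finset (Fin n), S.card ≤ d → ∀ x, avg μ Sᶜ f x ≤ r ^ S.card * p)
    (S : Finset (Fin n)) (hS : S.card ≤ d) (x : Fin n → Ω) :
    avg μ Sᶜ |lap μ S f| x ≤ (1 + r) ^ S.card * p := by
  have h := avg_mono μ Sᶜ (abs_lap_le μ hf S) x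
  rw [map_sum, Finset.sum_apply] at h
  refine h.trans ?_
  rw [← Finset.sum_pow_mul_eq_add_pow, Finset.sum_mul]
  refine Finset.sum_le_sum fun T hT => ?_
  have hT' := Finset.mem_powerset.1 hT
  have hc : Sᶜ ∪ T = (S \ T)ᶜ := by
    ext i; simp; tauto
  rw [avg_avg, hc, one_pow, one_mul, ← Finset.card_sdiff_of_subset hT']
  exact hglobal _ ((Finset.card_le_card Finset.sdiff_subset).trans hS) x

/-- Boundedness of f gives |L_S f| ≤ 2^|S| ≤ (1 + r)^|S|; the other factor is controlled in L¹. -/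
theorem avg_sq_lap_le {f : (Fin n → Ω) → ℝ} (hf : 0 ≤ f) (hf1 : f ≤ 1) {r p : ℝ} (hr : 1 ≤ r)
    {d : ℕ}
    (hglobal : ∀ S : Finset (Fin n), S.card ≤ d → ∀ x, avg μ Sᶜ f x ≤ r ^ S.card * p)
    (S : Finset (Fin n)) (hS : S.card ≤ d) (x : Fin n → Ω) :
    avg μ Sᶜ (lap μ S f ^ 2) x ≤ (1 + r) ^ (2 * S.card) * p := by
  have h1 : lap μ S f ^ 2 ≤ (2 : ℝ) ^ S.card • |lap μ S f| := by
    intro y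
    have hle : |lap μ S f y| ≤ 2 ^ S.card := by
      refine (abs_lap_le μ hf S y).trans ?_
      rw [Finset.sum_apply]
      calc ∑ T ∈ S.powerset, avg μ T f y ≤ ∑ T ∈ S.powerset, (1 : ℝ) :=
            Finset.sum_le_sum fun T _ => by simpa [avg_one] using avg_mono μ T hf1 y
        _ = 2 ^ S.card := by simp
    simp only [Pi.pow_apply, Pi.smul_apply, Pi.abs_apply, smul_eq_mul]
    rw [← sq_abs, sq]
    exact mul_le_mul_of_nonneg_right hle (abs_nonneg _)
  have h := avg_mono μ Sᶜ h1 x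
  rw [map_smul] at h
  have h2 := avg_abs_lap_le μ hf hglobal S hS x
  calc avg μ Sᶜ (lap μ S f ^ 2) x ≤ 2 ^ S.card * avg μ Sᶜ |lap μ S f| x := h
    _ ≤ (1 + r) ^ S.card * ((1 + r) ^ S.card * p) := by
        gcongr
        · exact avg_nonneg μ _ (abs_nonneg _) x
        · linarith
    _ = _ := by rw [two_mul, pow_add, mul_assoc]

end Main
end LevelInequality

theorem mainTheorem2 {Ω : Type*} [Fintype Ω] [MeasurableSpace Ω] [MeasurableSingletonClass Ω]
    (μ : Measure Ω) [IsProbabilityMeasure μ] (n : ℕ)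
    (f : (Fin n → Ω) → ℝ) (hf : ∀ x, f x = 0 ∨ f x = 1)
    (hpos : 0 < LevelInequality.expect μ f)
    (r : ℝ) (hr : 1 < r) (d : ℕ)
    (hd : (d : ℝ) ≤ (1 / 4 : ℝ) * Real.log (1 / LevelInequality.expect μ f))
    (hglobal : ∀ S : Finset (Fin n), S.card ≤ d → ∀ x : {i // i ∈ S} → Ω,
      LevelInequality.expect μ (LevelInequality.restrict f S x)
        ≤ r ^ S.card * LevelInequality.expect μ f) :
    LevelInequality.l2Norm μ (LevelInequality.levelPart μ d f) ^ 2
      ≤ LevelInequality.expect μ f ^ 2 *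
          (2200 * r ^ 2 * Real.log (1 / LevelInequality.expect μ f) / (d : ℝ)) ^ d := by
  open LevelInequality in
  obtain ⟨ω⟩ : Nonempty Ω := μ.nonempty_of_neZero
  set p := expect μ f with hp
  have hf0 : 0 ≤ f := fun x => by rcases hf x with h | h <;> simp [h]
  have hf1 : f ≤ 1 := fun x => by rcases hf x with h | h <;> simp [h]
  have hp1 : p ≤ 1 := by
    simpa [expect_const] using expect_mono μ (g := f) (h := fun _ => 1) hf1
  have hL0 : 0 ≤ Real.log (1 / p) := Real.log_nonneg (by rw [le_div_iff₀ hpos]; linarith)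
  have hglob : ∀ S : Finset (Fin n), S.card ≤ d → ∀ x, avg μ Sᶜ f x ≤ r ^ S.card * p :=
    fun S hS x => by
      rw [avg_compl_eq_expect_restrict]
      exact hglobal S hS _
  have h := weightAbove_le μ (d := d) (f := f) (p := p) (ρ := 1 + r) hpos (by linarith) (by linarith)
    (avg_abs_lap_le μ hf0 hglob) (avg_sq_lap_le μ hf0 hf1 hr.le hglob) d ∅ (by simp)
    (fun _ => ω)
  rw [l2Norm_levelPart_sq μ d f fun _ => ω]
  refine h.trans ?_
  rw [Finset.card_empty, mul_zero, pow_zero, one_mul]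
  -- Here 1 + r ≤ 2r, and 4 · 550 = 2200.
  have hr2 : 550 * (1 + r) ^ 2 ≤ 2200 * r ^ 2 := by nlinarith
  gcongr
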